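/- **Setting.** Let $L,M,\beta>0$ and let $f:\mathbb R^n\to\mathbb R$ be coercive, $C^2$, real analytic near each of its strict saddle points (critical points whose Hessian has a negative eigenvalue), with $\|\nabla f(x)-\nabla f(y)\|\le L\|x-y\|$ and $\|\nabla^2 f(x)-\nabla^2 f(y)\|_2\le M\|x-y\|$, and such that $|\lambda|>\beta$ for every eigenvalue $\lambda$ of $\nabla^2 f$ at each critical point and in a neighbourhood of it. **Algorithm (CCRGD).** Fix $\varepsilon>0$, a threshold $P_{\min}\in\mathbb R$ and put $\alpha=1/L$, $\kappa=\beta/L$. The state is an iterate $x_k$ and a flag $\Xi_k\in\{0,1\}$, $\Xi_0=0$. If $\|\nabla f(x_k)\|>L\varepsilon$, then $x_{k+1}=x_k-\alpha\nabla f(x_k)$ and $\Xi_{k+1}=0$. If $\|\nabla f(x_k)\|\le L\varepsilon$ and $\Xi_k=1$, then $x_{k+1}=x_k-\alpha\nabla f(x_k)$ and $\Xi_{k+1}=1$. If $\|\nabla f(x_k)\|\le L\varepsilon$ and $\Xi_k=0$, put $y_0=x_k$, $y_1=y_0-\alpha\nabla f(y_0)$, $V_1=\|y_1-y_0\|^2$,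 $V_2=\alpha\langle y_1-y_0,\nabla f(y_1)-\nabla f(y_0)\rangle$. If $\frac{4\varepsilon^2}{27\kappa^2}<V_1-V_2<\frac{50P_{\min}+4}{27}\frac{\varepsilon^2}{\kappa^2}$, or if $0<V_1-V_2\le\frac{4\varepsilon^2}{27\kappa^2}$ and $\nabla^2 f(x_k)$ has a negative eigenvalue, then $x_{k+1}$ is any minimiser of $\frac12(x-x_k)^T\alpha\nabla^2f(x_k)(x-x_k)$ over $\|x-x_k\|=\|\nabla f(x_k)\|/\beta$; if $0<V_1-V_2\le\frac{4\varepsilon^2}{27\kappa^2}$ and there is no negative eigenvalue, the algorithm stops; in the remaining cases $x_{k+1}=y_1$. Unless it stopped, $\Xi_{k+1}=1$. **Data.** Let $x_0,\dots,x_T$ be generated by CCRGD with $\|x_0-x_0^*\|\le\xi$ for a strict saddle $x_0^*$, and let $R_0\ge\xi>0$. Suppose the trajectory escapes the ball of radius $R_0$ about $x^*_0$ (some $\|x_k-x_0^*\|>R_0$ with $k\le T$) and is back in it at the finite time $T$ ($\|x_T-x_0^*\|\le R_0$). Let $R_\omega=\max_{k\le T}\|x_k-x_0^*\|$, so that the trajectory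 does not leave the closed ball of radius $R_\omega$ about $x_0^*$ up to time $T$. Let $\mathcal U\supseteq\mathcal B_{R_\omega}(x_0^*)$ be compact with $x^*_0\in\mathcal U$, let $\mathcal S_*$ be the set of critical points of $f$ in $\mathcal U$, and assume it has at least two elements, any two at distance at least $R>0$. Let $\gamma$ satisfy $\|\nabla f(x)\|\ge\gamma$ for all $x\in\mathcal U\setminus\bigcup_{p\in\mathcal S_*}\bar{\mathcal B}_\xi(p)$. Let $K_{exit}$ be any upper bound for the number of iterates $x_k$, $k\le T$, in $\mathcal B_\varepsilon(p)$, and $K_{shell}$ any upper bound for the number of those in $\bar{\mathcal B}_\xi(p)\setminus\mathcal B_\varepsilon(p)$, uniformly over the strict saddles $p\in\mathcal S_*$. **Size conditions.** Assume $L\varepsilon<\gamma$, $M\xi\le\beta$, $50\,\xi\le R$, $50\big(\frac1\beta+\frac{L}{2\beta^2}\big)L^2\varepsilon^2\le\gamma R$, and $$\Delta:=\frac\gamma2-\Big(\frac1\beta+\frac{L}{2\beta^2}\Big)\frac{L^2\varepsilon^2}{R}-\gamma(K_{exit}+K_{shell})\frac{\xi}{R}>0 .$$ **Theorem.** With $N_0=2L\,\mathrm{diam}(\mathcal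 U)\frac{R_0}{R}\big/\Delta$, $$R_\omega\le R_0+2L\,\mathrm{diam}(\mathcal U)\frac{R_0}{\gamma}+N_0\Big(\frac1\beta+\frac{L}{2\beta^2}\Big)\frac{L^2\varepsilon^2}{\gamma}+N_0(K_{exit}+K_{shell})\,\xi ,$$ and the set of strict saddles $p\in\mathcal S_*$ whose neighbourhood $\bar{\mathcal B}_\xi(p)$ contains some $x_k$, $k\le T$, is finite and has at most $N_0$ elements. The constant $N_0$ has no explicit dependence on the dimension $n$. -/

import Mathlib

namespace CCRGD

/-- The Euclidean space `ℝⁿ`. -/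
abbrev E (n : ℕ) : Type := EuclideanSpace ℝ (Fin n)

/-- The Hessian of `f` at `x`, as the continuous linear map `D(∇f)(x)`. -/
noncomputable def hess {n : ℕ} (f : E n → ℝ) (x : E n) : E n →L[ℝ] E n :=
  fderiv ℝ (gradient f) x

/-- `μ` is an eigenvalue of the Hessian of `f` at `x`. -/
def IsHessEigenvalue {n : ℕ} (f : E n → ℝ) (x : E n) (μ : ℝ) : Prop :=
  Module.End.HasEigenvalue (hess f x : E n →ₗ[ℝ] E n) μ

/-- A strict saddle point: a critical point whose Hessian has at least one negative eigenvalue. -/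
def IsStrictSaddle {n : ℕ} (f : E n → ℝ) (p : E n) : Prop :=
  gradient f p = 0 ∧ ∃ μ < 0, IsHessEigenvalue f p μ

/-- The function class: coercive, `C²`, analytic around its strict saddle points, with `L`-Lipschitz
gradient and `M`-Lipschitz Hessian, and Morse with all eigenvalues of the Hessian larger than `β` in
absolute value at the critical points and in a neighbourhood of each of them. -/
structure Admissible {n : ℕ} (f : E n → ℝ) (L M β : ℝ) : Prop where
  coercive : Filter.Tendsto f (Filter.cocompact (E n)) Filter.atTop
  smooth : ContDiff ℝ 2 f
  analytic : ∀ p, IsStrictSaddle f p → AnalyticAt ℝ f p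
  grad_lipschitz : ∀ x y, ‖gradient f x - gradient f y‖ ≤ L * ‖x - y‖
  hess_lipschitz : ∀ x y, ‖hess f x - hess f y‖ ≤ M * ‖x - y‖
  morse : ∀ p, gradient f p = 0 → ∀ μ, IsHessEigenvalue f p μ → β < |μ|
  morse_near : ∀ p, gradient f p = 0 →
    ∃ W : Set (E n), IsOpen W ∧ p ∈ W ∧ ∀ y ∈ W, ∀ μ, IsHessEigenvalue f y μ → β < |μ|

/-- The gradient descent update with step size `1 / L`. -/
noncomputable def gdStep {n : ℕ} (f : E n → ℝ) (L : ℝ) (x : E n) : E n :=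
  x - (1 / L) • gradient f x

/-- The quantity `V₁ - V₂` of the curvature check at `y₀ = x`, where `y₁ = y₀ - (1/L) ∇f(y₀)`,
`V₁ = ⟨y₁ - y₀, y₁ - y₀⟩` and `V₂ = (1/L) ⟨y₁ - y₀, ∇f(y₁) - ∇f(y₀)⟩`. -/
noncomputable def curvatureGap {n : ℕ} (f : E n → ℝ) (L : ℝ) (x : E n) : ℝ :=
  inner ℝ (gdStep f L x - x) (gdStep f L x - x)
    - (1 / L) * inner ℝ (gdStep f L x - x) (gradient f (gdStep f L x) - gradient f x)

/-- `x'` solves the constrained eigenvalue problem at `x`: it minimises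
`½ (y - x)ᵀ H (y - x)`, `H = (1/L) ∇²f(x)`, over the sphere `‖y - x‖ = ‖∇f(x)‖ / β`. -/
def IsSecondOrderStep {n : ℕ} (f : E n → ℝ) (L β : ℝ) (x x' : E n) : Prop :=
  ‖x' - x‖ = ‖gradient f x‖ / β ∧
    ∀ y : E n, ‖y - x‖ = ‖gradient f x‖ / β →
      (1 / 2) * inner ℝ (x' - x) (((1 / L) • hess f x) (x' - x)) ≤
        (1 / 2) * inner ℝ (y - x) (((1 / L) • hess f x) (y - x))

/-- The lower threshold `4 ε² / (27 κ²)` of the curvature check, `κ = β / L`. -/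
noncomputable def lowThreshold (L β ε : ℝ) : ℝ := 4 * ε ^ 2 / (27 * (β / L) ^ 2)

/-- The upper threshold `((50 Pmin + 4) / 27) ε² / κ²` of the curvature check, `κ = β / L`. -/
noncomputable def highThreshold (L β ε Pmin : ℝ) : ℝ :=
  (50 * Pmin + 4) / 27 * (ε ^ 2 / (β / L) ^ 2)

/-- One iteration of the Curvature Conditioned Regularized Gradient Descent method, as a relation
between consecutive states (iterate, condition flag). There is no successor state exactly
when the algorithm breaks (small gradient, flag down, `0 < V₁ - V₂ ≤ 4 ε² / (27 κ²)` and no negative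
eigenvalue). When neither curvature check fires the update is the gradient step `y₁`. -/
inductive Step {n : ℕ} (f : E n → ℝ) (L β ε Pmin : ℝ) : E n × Bool → E n × Bool → Prop
  | large_gradient (x : E n) (flag : Bool) (hg : L * ε < ‖gradient f x‖) :
      Step f L β ε Pmin (x, flag) (gdStep f L x, false)
  | flagged (x : E n) (hg : ‖gradient f x‖ ≤ L * ε) :
      Step f L β ε Pmin (x, true) (gdStep f L x, true)
  | high_curvature (x x' : E n) (hg : ‖gradient f x‖ ≤ L * ε)
      (hlow : lowThreshold L β ε < curvatureGap f L x)
      (hhigh : curvatureGap f L x < highThreshold L β ε Pmin)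
      (hx' : IsSecondOrderStep f L β x x') :
      Step f L β ε Pmin (x, false) (x', true)
  | low_curvature (x x' : E n) (hg : ‖gradient f x‖ ≤ L * ε)
      (hpos : 0 < curvatureGap f L x) (hlow : curvatureGap f L x ≤ lowThreshold L β ε)
      (hneg : ∃ μ < 0, IsHessEigenvalue f x μ)
      (hx' : IsSecondOrderStep f L β x x') :
      Step f L β ε Pmin (x, false) (x', true)
  | no_check (x : E n) (hg : ‖gradient f x‖ ≤ L * ε)
      (h₁ : ¬ (lowThreshold L β ε < curvatureGap f L x ∧
        curvatureGap f L x < highThreshold L β ε Pmin))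
      (h₂ : ¬ (0 < curvatureGap f L x ∧ curvatureGap f L x ≤ lowThreshold L β ε)) :
      Step f L β ε Pmin (x, false) (gdStep f L x, true)

/-- `x 0, …, x T` are iterates of the algorithm, with condition flags `Ξ 0 = 0, …, Ξ T`. -/
def IsTrajectory {n : ℕ} (f : E n → ℝ) (L β ε Pmin : ℝ) (T : ℕ) (x : ℕ → E n) (Ξ : ℕ → Bool) :
    Prop :=
  Ξ 0 = false ∧ ∀ k < T, Step f L β ε Pmin (x k, Ξ k) (x (k + 1), Ξ (k + 1))

/-- The set `S_*` of the critical points of `f` in `U`. -/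
def criticalIn {n : ℕ} (f : E n → ℝ) (U : Set (E n)) : Set (E n) :=
  {p | p ∈ U ∧ gradient f p = 0}

/-- The strict saddle points of `f` in `U`. -/
def saddlesIn {n : ℕ} (f : E n → ℝ) (U : Set (E n)) : Set (E n) :=
  {p | p ∈ U ∧ IsStrictSaddle f p}

/-- The number of the iterates `x 0, …, x T` that lie in `S`. -/
noncomputable def timeIn {n : ℕ} (T : ℕ) (x : ℕ → E n) (S : Set (E n)) : ℕ :=
  {k : ℕ | k ≤ T ∧ x k ∈ S}.ncard

/-- The longest time the trajectory spends in an `ε`-ball around a strict saddle point in `U`. -/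
noncomputable def exitTime {n : ℕ} (f : E n → ℝ) (U : Set (E n)) (ε : ℝ) (T : ℕ) (x : ℕ → E n) :
    ℕ :=
  ⨆ p : saddlesIn f U, timeIn T x (Metric.ball p.1 ε)

/-- The longest sojourn time of the trajectory in a shell between the open `ε`-ball and the closed
`ξ`-ball around a strict saddle point in `U`. -/
noncomputable def shellTime {n : ℕ} (f : E n → ℝ) (U : Set (E n)) (ε ξ : ℝ) (T : ℕ)
    (x : ℕ → E n) : ℕ :=
  ⨆ p : saddlesIn f U, timeIn T x (Metric.closedBall p.1 ξ \ Metric.ball p.1 ε)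

theorem timeIn_le {n : ℕ} (T : ℕ) (x : ℕ → E n) (S : Set (E n)) : timeIn T x S ≤ T + 1 := by
  have h : {k : ℕ | k ≤ T ∧ x k ∈ S} ⊆ (Finset.range (T + 1) : Set ℕ) := by
    intro k hk
    have := hk.1
    simp only [Finset.coe_range, Set.mem_Iio]
    omega
  have h2 := Set.ncard_le_ncard h (Finset.finite_toSet _)
  rw [Set.ncard_coe_finset, Finset.card_range] at h2
  exact h2

/-- The supremum in `exitTime` is over a bounded family, hence a genuine maximum. -/
theorem le_exitTime {n : ℕ} (f : E n → ℝ) (U : Set (E n)) (ε : ℝ) (T : ℕ) (x : ℕ → E n)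
    {p : E n} (hp : p ∈ saddlesIn f U) : timeIn T x (Metric.ball p ε) ≤ exitTime f U ε T x :=
  le_ciSup (f := fun p : saddlesIn f U => timeIn T x (Metric.ball p.1 ε))
    ⟨T + 1, by rintro _ ⟨q, rfl⟩; exact timeIn_le T x _⟩ ⟨p, hp⟩

/-- The supremum in `shellTime` is over a bounded family, hence a genuine maximum. -/
theorem le_shellTime {n : ℕ} (f : E n → ℝ) (U : Set (E n)) (ε ξ : ℝ) (T : ℕ) (x : ℕ → E n)
    {p : E n} (hp : p ∈ saddlesIn f U) :
    timeIn T x (Metric.closedBall p ξ \ Metric.ball p ε) ≤ shellTime f U ε ξ T x :=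
  le_ciSup (f := fun p : saddlesIn f U =>
      timeIn T x (Metric.closedBall p.1 ξ \ Metric.ball p.1 ε))
    ⟨T + 1, by rintro _ ⟨q, rfl⟩; exact timeIn_le T x _⟩ ⟨p, hp⟩

/-- The radius `R_ω` of the farthest excursion from `p`: the maximum over `k ≤ T` of
`‖x k - p‖`. -/
noncomputable def farthestRadius {n : ℕ} (p : E n) (T : ℕ) (x : ℕ → E n) : ℝ :=
  (Finset.range (T + 1)).sup' Finset.nonempty_range_add_one (fun k => ‖x k - p‖)

/-- The strict saddle points in `U` whose (closed) `ξ`-neighbourhood the trajectory meets. -/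
def saddlesMet {n : ℕ} (f : E n → ℝ) (U : Set (E n)) (ξ : ℝ) (T : ℕ) (x : ℕ → E n) : Set (E n) :=
  {p | p ∈ saddlesIn f U ∧ ∃ k ≤ T, x k ∈ Metric.closedBall p ξ}

/-- `(1/β + L/(2β²)) L² ε²`. -/
noncomputable def stepCost (L β ε : ℝ) : ℝ := (1 / β + L / (2 * β ^ 2)) * (L ^ 2 * ε ^ 2)

/-- `γ/2 - (1/β + L/(2β²)) L² ε² / R - γ (K_exit + K_shell) ξ / R`, the denominator of `N₀`. -/
noncomputable def denomN (L β ε ξ γ R Kexit Kshell : ℝ) : ℝ :=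
  γ / 2 - stepCost L β ε / R - γ * (Kexit + Kshell) * (ξ / R)

/-- The dimension-free bound `N₀` on the number of saddle neighbourhoods, `D = diam U`. -/
noncomputable def boundN (L β ε ξ γ R D R₀ Kexit Kshell : ℝ) : ℝ :=
  2 * L * D * (R₀ / R) / denomN L β ε ξ γ R Kexit Kshell

end CCRGD

/-! The function `f` is a potential, and visiting a new critical point costs a fixed amount of it. A
gradient step lowers `f` by at least `‖∇f‖ / 2` times its length, hence by `γ / 2` per unit of
length outside the `ξ`-balls, and different balls are about `R` apart. A second-order step may raise
`f` by `c = stepCost`, but it needs `‖∇f‖ ≤ Lε < γ`, so it starts in some `ξ`-ball, where the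
nondegenerate Hessian forces `|f - f(q)| ≤ 4c`. Hence jumps near one centre do not accumulate: the
first shows that `f(q) - 4c` is below the current budget, and after any jump `f ≤ f(q) + 5c`, so a
stay at `q` gains at most `9c`, however long it is. As `50c ≤ γR`, each change of centre loses a net
`57/200 γR` (`exists_finset_centers_potential`).

The total drop of `f` is at most `L R₀²`, since both ends of the trajectory lie within `R₀` of a
critical point; this bounds the number of saddles.

The radius bound needs only `R_ω ≤ diam U` and `γ ≤ 11/10 L R₀`: the gradient vanishes at `p₀` and
is `L`-Lipschitz, so it is still small just outside the `ξ`-ball. The first `diam U` term then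
exceeds `R_ω` already. -/

/-- A trajectory which loses `γ / 2` of potential per unit of length outside the `ξ`-balls about an
`R`-separated set of centres, and gains at most `c` per jump, jumps taking place inside the balls
and at potential `4 c`-close to a value attached to the centre, meets few of these balls. -/
theorem exists_finset_centers_potential {E : Type*} [SeminormedAddCommGroup E] (C : Set E)
    (F : E → ℝ) (φ : ℕ → ℝ) (x : ℕ → E) (T : ℕ) {R ξ s γ c : ℝ} (hc : 0 ≤ c) (hγ : 0 ≤ γ)
    (hR : 0 < R) (hsep : ∀ p ∈ C, ∀ q ∈ C, p ≠ q → R ≤ ‖p - q‖)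
    (hξR : 50 * ξ ≤ R) (hsR : 100 * s ≤ 3 * R) (hs : 0 ≤ s) (hcR : 50 * c ≤ γ * R)
    {p₀ : E} (hp₀ : p₀ ∈ C) (hx₀ : ‖x 0 - p₀‖ ≤ ξ)
    (hstep : ∀ t < T,
      (φ (t + 1) ≤ φ t ∧
        ((∃ q ∈ C, ‖x t - q‖ ≤ ξ) → ‖x (t + 1) - x t‖ ≤ s) ∧
        ((∀ q ∈ C, ξ < ‖x t - q‖) → φ (t + 1) + γ / 2 * ‖x (t + 1) - x t‖ ≤ φ t)) ∨
      (∃ q ∈ C, ‖x t - q‖ ≤ ξ ∧ |φ t - F q| ≤ 4 * c ∧ φ (t + 1) ≤ φ t + c ∧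
        ‖x (t + 1) - x t‖ ≤ s)) (t : ℕ) (ht : t ≤ T) :
    ∃ V : Finset E, (∀ p ∈ C, (∃ k ≤ t, ‖x k - p‖ ≤ ξ) → p ∈ V) ∧ ∃ q ∈ C, q ∈ V ∧
      (∀ p ∈ C, ‖x t - p‖ ≤ ξ → p = q) ∧
      (φ t + γ / 2 * max 0 (‖x t - q‖ - ξ - s) ≤ φ 0 - (V.card - 1) * (57 / 200 * (γ * R)) ∨
        F q - 4 * c ≤ φ 0 - (V.card - 1) * (57 / 200 * (γ * R)) ∧
        φ t + γ / 2 * max 0 (‖x t - q‖ - ξ - s) ≤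
          φ 0 - (V.card - 1) * (57 / 200 * (γ * R)) + 9 * c) := by
  classical
  have hγR : 0 ≤ γ * R := by positivity
  have huniq : ∀ y, ∀ p ∈ C, ∀ q ∈ C, ‖y - p‖ ≤ ξ → ‖y - q‖ ≤ ξ → p = q := by
    intro y p hp q hq h1 h2
    by_contra hne
    have h3 := hsep p hp q hq hne
    have h4 : ‖p - q‖ ≤ ‖y - p‖ + ‖y - q‖ := by
      rw [norm_sub_rev y p]; exact norm_sub_le_norm_sub_add_norm_sub p y q
    linarith
  induction t with
  | zero =>
    refine ⟨{p₀}, ?_, p₀, hp₀, by simp, fun p hp h => huniq _ p hp p₀ hp₀ h hx₀, Or.inl ?_⟩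
    · rintro p hp ⟨k, hk, h⟩
      obtain rfl : k = 0 := by omega
      simpa using huniq _ p hp p₀ hp₀ h hx₀
    · rw [max_eq_left (by linarith)]
      simp
  | succ t ih =>
    obtain ⟨V, hV, q, hq, hqV, hqu, hpot⟩ := ih (by omega)
    set A := φ 0 - (V.card - 1) * (57 / 200 * (γ * R)) with hA
    have htri : ‖x (t + 1) - q‖ ≤ ‖x (t + 1) - x t‖ + ‖x t - q‖ :=
      norm_sub_le_norm_sub_add_norm_sub _ _ _
    -- Left: no jump has been charged to the current centre `q`. Right: one has, and the excess `9c`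
    -- is paid once for the whole stay at `q`. The distance term is the descent already owed for
    -- leaving `q`; the offset `ξ + s` leaves the step out of the ball uncharged.
    have key : φ (t + 1) + γ / 2 * max 0 (‖x (t + 1) - q‖ - ξ - s) ≤ A ∨
        F q - 4 * c ≤ A ∧ φ (t + 1) + γ / 2 * max 0 (‖x (t + 1) - q‖ - ξ - s) ≤ A + 9 * c := by
      have hpos : 0 ≤ γ / 2 * max 0 (‖x t - q‖ - ξ - s) := by positivity
      rcases hstep t (by omega) with ⟨h1, h2, h3⟩ | ⟨q', hq', h1, h2, h3, h4⟩
      · have hle : φ (t + 1) + γ / 2 * max 0 (‖x (t + 1) - q‖ - ξ - s) ≤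
            φ t + γ / 2 * max 0 (‖x t - q‖ - ξ - s) := by
          by_cases hin : ∃ q ∈ C, ‖x t - q‖ ≤ ξ
          · have h5 := h2 hin
            obtain ⟨q', hq', h6⟩ := hin
            obtain rfl := hqu q' hq' h6
            rw [max_eq_left (a := (0 : ℝ)) (b := ‖x (t + 1) - q'‖ - ξ - s) (by linarith)]
            linarith
          · push Not at hin
            have h5 := h3 hin
            have h6 : max 0 (‖x (t + 1) - q‖ - ξ - s) ≤
                ‖x (t + 1) - x t‖ + max 0 (‖x t - q‖ - ξ - s) := by
              apply max_le
              · positivity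
              · linarith [le_max_right 0 (‖x t - q‖ - ξ - s)]
            have h7 := mul_le_mul_of_nonneg_left h6 (show 0 ≤ γ / 2 by positivity)
            linarith
        rcases hpot with h | ⟨h, h'⟩
        · exact Or.inl (by linarith)
        · exact Or.inr ⟨h, by linarith⟩
      · obtain rfl := hqu q' hq' h1
        rw [max_eq_left (a := (0 : ℝ)) (b := ‖x (t + 1) - q'‖ - ξ - s) (by linarith)]
        rw [abs_le] at h2
        rcases hpot with h | ⟨h, h'⟩
        · exact Or.inr ⟨by linarith, by linarith⟩
        · exact Or.inr ⟨h, by linarith⟩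
    have hpast : ∀ p, (∃ k ≤ t + 1, ‖x k - p‖ ≤ ξ) →
        (∃ k ≤ t, ‖x k - p‖ ≤ ξ) ∨ ‖x (t + 1) - p‖ ≤ ξ := by
      rintro p ⟨k, hk, h⟩
      rcases Nat.le_succ_iff.1 hk with h' | rfl
      · exact Or.inl ⟨k, h', h⟩
      · exact Or.inr h
    by_cases hnew : ∃ p ∈ C, ‖x (t + 1) - p‖ ≤ ξ ∧ p ≠ q
    · obtain ⟨p, hp, hxp, hpq⟩ := hnew
      refine ⟨insert p V, ?_, p, hp, Finset.mem_insert_self _ _,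
        fun p' hp' h => huniq _ p' hp' p hp h hxp, Or.inl ?_⟩
      · intro p' hp' h
        rcases hpast p' h with h | h
        · exact Finset.mem_insert_of_mem (hV p' hp' h)
        · rw [huniq _ p' hp' p hp h hxp]
          exact Finset.mem_insert_self _ _
      · have h1 := hsep p hp q hq hpq
        have h2 : ‖p - q‖ ≤ ‖x (t + 1) - p‖ + ‖x (t + 1) - q‖ := by
          rw [norm_sub_rev _ p]; exact norm_sub_le_norm_sub_add_norm_sub p _ q
        -- `R` minus two radii `ξ ≤ R/50` and `s ≤ 3R/100`. Half of `93/100` minus `9/50` (from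
        -- `9c`) is `57/200`. A revisited centre leaves `V` unchanged, which only weakens the claim.
        have h3 : 93 / 100 * R ≤ max 0 (‖x (t + 1) - q‖ - ξ - s) :=
          le_max_of_le_right (by linarith)
        have h4 := mul_le_mul_of_nonneg_left h3 (show 0 ≤ γ / 2 by positivity)
        have h5 : ((insert p V).card : ℝ) ≤ V.card + 1 := by
          exact_mod_cast Finset.card_insert_le p V
        have h6 := mul_le_mul_of_nonneg_right h5 (show 0 ≤ 57 / 200 * (γ * R) by positivity)
        rw [max_eq_left (by linarith)]
        rcases key with h | ⟨-, h⟩ <;> linarith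
    · push Not at hnew
      refine ⟨V, ?_, q, hq, hqV, hnew, key⟩
      intro p hp h
      rcases hpast p h with h | h
      · exact hV p hp h
      · rwa [hnew p hp h]

/-! ### Taylor remainders and nondegenerate symmetric operators -/

/-- Quadratic Taylor remainder for a map whose derivative is `C`-Lipschitz at `x`. -/
theorem norm_sub_sub_fderiv_le_of_fderiv_lipschitz {E G : Type*} [NormedAddCommGroup E]
    [NormedSpace ℝ E] [NormedAddCommGroup G] [NormedSpace ℝ G] {F : E → G}
    (hF : Differentiable ℝ F) {C : ℝ} {x : E}
    (hC : ∀ y, ‖fderiv ℝ F y - fderiv ℝ F x‖ ≤ C * ‖y - x‖) (y : E) :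
    ‖F y - F x - fderiv ℝ F x (y - x)‖ ≤ C / 2 * ‖y - x‖ ^ 2 := by
  set d := y - x with hd
  have hφ : ∀ t : ℝ, HasDerivAt (fun t : ℝ => F (x + t • d) - F x - t • fderiv ℝ F x d)
      (fderiv ℝ F (x + t • d) d - fderiv ℝ F x d) t := by
    intro t
    have h1 : HasDerivAt (fun t : ℝ => x + t • d) d t := by
      simpa using ((hasDerivAt_id t).smul_const d).const_add x
    have h2 := (hF (x + t • d)).hasFDerivAt.comp_hasDerivAt t h1
    have h3 : HasDerivAt (fun t : ℝ => t • fderiv ℝ F x d) (fderiv ℝ F x d) t := by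
      simpa using (hasDerivAt_id t).smul_const (fderiv ℝ F x d)
    exact (h2.sub_const (F x)).sub h3
  have hB : ∀ t : ℝ, HasDerivAt (fun t : ℝ => C / 2 * ‖d‖ ^ 2 * t ^ 2) (C * ‖d‖ ^ 2 * t) t := by
    intro t
    refine ((hasDerivAt_pow 2 t).const_mul (C / 2 * ‖d‖ ^ 2)).congr_deriv ?_
    push_cast
    ring
  -- Along the segment from `x` to `y`, the remainder at time `t` is compared with `C/2 ‖d‖² t²`.
  have := image_norm_le_of_norm_deriv_right_le_deriv_boundary
    (f := fun t : ℝ => F (x + t • d) - F x - t • fderiv ℝ F x d) (a := 0) (b := 1)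
    (fun t _ => (hφ t).continuousAt.continuousWithinAt) (fun t _ => (hφ t).hasDerivWithinAt)
    (B := fun t => C / 2 * ‖d‖ ^ 2 * t ^ 2) (by simp) hB
    (by
      intro t ht
      rw [← sub_apply]
      calc _ ≤ ‖fderiv ℝ F (x + t • d) - fderiv ℝ F x‖ * ‖d‖ :=
            ContinuousLinearMap.le_opNorm _ _
        _ ≤ C * ‖x + t • d - x‖ * ‖d‖ := by gcongr; exact hC _
        _ = C * ‖d‖ ^ 2 * t := by
          rw [add_sub_cancel_left, norm_smul, Real.norm_of_nonneg ht.1]; ring)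
    (Set.right_mem_Icc.2 zero_le_one)
  simpa [hd] using this

/-- A symmetric operator whose eigenvalues are at least `β` in absolute value is bounded below
by `β`. -/
theorem LinearMap.IsSymmetric.mul_norm_le_norm_apply {E : Type*} [NormedAddCommGroup E]
    [InnerProductSpace ℝ E] [FiniteDimensional ℝ E] {S : E →ₗ[ℝ] E} (hS : S.IsSymmetric)
    {β : ℝ} (hβ : 0 ≤ β) (h : ∀ μ, Module.End.HasEigenvalue S μ → β ≤ |μ|) (v : E) :
    β * ‖v‖ ≤ ‖S v‖ := by
  -- In an orthonormal eigenbasis the inequality holds coordinate by coordinate.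
  set b := hS.eigenvectorBasis rfl with hb
  refine (sq_le_sq₀ (by positivity) (norm_nonneg _)).1 ?_
  rw [mul_pow, ← b.repr.norm_map v, ← b.repr.norm_map (S v), EuclideanSpace.norm_sq_eq,
    EuclideanSpace.norm_sq_eq, Finset.mul_sum]
  refine Finset.sum_le_sum fun i _ => ?_
  rw [hb, hS.eigenvectorBasis_apply_self_apply rfl v i, norm_mul, mul_pow]
  gcongr
  exact h _ (hS.hasEigenvalue_eigenvalues rfl i)

/-! ### Local estimates for `f` and for one step of the algorithm -/

namespace CCRGD

variable {n : ℕ} {f : E n → ℝ} {L M β : ℝ}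

theorem fderiv_eq_toDual_gradient (f : E n → ℝ) (x : E n) :
    fderiv ℝ f x = InnerProductSpace.toDual ℝ (E n) (gradient f x) := by
  simp [gradient]

theorem fderiv_apply_eq_inner_gradient (f : E n → ℝ) (x v : E n) :
    fderiv ℝ f x v = inner ℝ (gradient f x) v := by
  rw [fderiv_eq_toDual_gradient, InnerProductSpace.toDual_apply_apply]

theorem Admissible.differentiable (hf : Admissible f L M β) : Differentiable ℝ f :=
  hf.smooth.differentiable two_ne_zero

theorem Admissible.differentiable_gradient (hf : Admissible f L M β) :
    Differentiable ℝ (gradient f) := by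
  have h : Differentiable ℝ (fderiv ℝ f) :=
    (hf.smooth.fderiv_right (m := 1) (by norm_num)).differentiable one_ne_zero
  exact (InnerProductSpace.toDual ℝ (E n)).symm.toContinuousLinearEquiv.differentiable.comp h

theorem Admissible.isSymmetric_hess (hf : Admissible f L M β) (x : E n) :
    (hess f x : E n →ₗ[ℝ] E n).IsSymmetric := by
  have hsymm : IsSymmSndFDerivAt ℝ f x := hf.smooth.contDiffAt.isSymmSndFDerivAt (by simp)
  have key : ∀ u v, fderiv ℝ (fderiv ℝ f) x u v = inner ℝ (hess f x u) v := by
    intro u v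
    have h1 : fderiv ℝ f =
        (InnerProductSpace.toDual ℝ (E n)).toContinuousLinearEquiv ∘ gradient f :=
      funext (fderiv_eq_toDual_gradient f)
    have h2 := ((InnerProductSpace.toDual ℝ (E n)).toContinuousLinearEquiv.hasFDerivAt).comp x
      (hf.differentiable_gradient x).hasFDerivAt
    rw [h1, h2.fderiv]
    exact InnerProductSpace.toDual_apply_apply
  intro u v
  change inner ℝ (hess f x u) v = inner ℝ u (hess f x v)
  rw [← key u v, hsymm.eq u v, key v u, real_inner_comm]

/-- The descent lemma, two-sided. -/
theorem Admissible.abs_sub_sub_inner_le (hf : Admissible f L M β) (x y : E n) :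
    |f y - f x - inner ℝ (gradient f x) (y - x)| ≤ L / 2 * ‖y - x‖ ^ 2 := by
  rw [← fderiv_apply_eq_inner_gradient, ← Real.norm_eq_abs]
  refine norm_sub_sub_fderiv_le_of_fderiv_lipschitz hf.differentiable (fun z => ?_) y
  rw [fderiv_eq_toDual_gradient, fderiv_eq_toDual_gradient, ← map_sub, LinearIsometryEquiv.norm_map]
  exact hf.grad_lipschitz z x

theorem Admissible.abs_sub_le_of_gradient_eq_zero (hf : Admissible f L M β) {p : E n}
    (hp : gradient f p = 0) (y : E n) : |f y - f p| ≤ L / 2 * ‖y - p‖ ^ 2 := by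
  simpa [hp] using hf.abs_sub_sub_inner_le p y

theorem Admissible.apply_gdStep_le (hf : Admissible f L M β) (hL : 0 < L) (x : E n) :
    f (gdStep f L x) + ‖gradient f x‖ ^ 2 / (2 * L) ≤ f x := by
  have h := (abs_le.1 (hf.abs_sub_sub_inner_le x (gdStep f L x))).2
  have h1 : gdStep f L x - x = -((1 / L) • gradient f x) := by simp [gdStep]
  rw [h1, inner_neg_right, inner_smul_right, real_inner_self_eq_norm_sq, norm_neg, norm_smul,
    Real.norm_of_nonneg (by positivity)] at h
  have h2 : L / 2 * (1 / L * ‖gradient f x‖) ^ 2 = ‖gradient f x‖ ^ 2 / (2 * L) := by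
    field_simp
  have h3 : 1 / L * ‖gradient f x‖ ^ 2 = 2 * (‖gradient f x‖ ^ 2 / (2 * L)) := by
    field_simp
  linarith

theorem norm_gdStep_sub (hL : 0 < L) (x : E n) :
    ‖gdStep f L x - x‖ = ‖gradient f x‖ / L := by
  have h1 : gdStep f L x - x = -((1 / L) • gradient f x) := by simp [gdStep]
  rw [h1, norm_neg, norm_smul, Real.norm_of_nonneg (by positivity)]
  ring

/-- Near a critical point the gradient controls the distance to that point. -/
theorem Admissible.mul_norm_sub_le_norm_gradient (hf : Admissible f L M β) (hβ : 0 ≤ β) {p : E n}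
    (hp : gradient f p = 0) {x : E n} (hx : M * ‖x - p‖ ≤ β) :
    β / 2 * ‖x - p‖ ≤ ‖gradient f x‖ := by
  have h1 := norm_sub_sub_fderiv_le_of_fderiv_lipschitz hf.differentiable_gradient
    (fun z => hf.hess_lipschitz z p) x
  have h2 := (hf.isSymmetric_hess p).mul_norm_le_norm_apply hβ
    (fun μ hμ => (hf.morse p hp μ hμ).le) (x - p)
  rw [hp, sub_zero] at h1
  -- The linear part has norm at least `β‖x - p‖`; the remainder `M/2 ‖x - p‖²` removes at most half
  -- of it.
  have h3 := norm_sub_norm_le (hess f p (x - p)) (gradient f x)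
  rw [norm_sub_rev] at h3
  have h4 := mul_le_mul_of_nonneg_right hx (norm_nonneg (x - p))
  change β * ‖x - p‖ ≤ ‖hess f p (x - p)‖ at h2
  change ‖gradient f x - hess f p (x - p)‖ ≤ _ at h1
  nlinarith

theorem Admissible.norm_gradient_le (hf : Admissible f L M β) {p : E n}
    (hp : gradient f p = 0) (x : E n) : ‖gradient f x‖ ≤ L * ‖x - p‖ := by
  simpa [hp] using hf.grad_lipschitz x p

theorem stepCost_nonneg (hL : 0 < L) (hβ : 0 < β) (ε : ℝ) : 0 ≤ stepCost L β ε := by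
  unfold stepCost; positivity

/-- A small gradient near `p` forces `‖x - p‖ ≤ 2Lε/β`, and `f` is quadratically flat at `p`. This
pins the level of `f` wherever a jump can start. -/
theorem Admissible.abs_sub_le_stepCost (hf : Admissible f L M β) (hL : 0 < L) (hβ : 0 < β)
    {p : E n} (hp : gradient f p = 0) {x : E n} (hx : M * ‖x - p‖ ≤ β) {ε : ℝ}
    (hg : ‖gradient f x‖ ≤ L * ε) : |f x - f p| ≤ 4 * stepCost L β ε := by
  have h1 := hf.mul_norm_sub_le_norm_gradient hβ.le hp hx
  have h2 : ‖x - p‖ ≤ 2 * (L * ε) / β := by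
    rw [le_div_iff₀ hβ]; linarith
  calc |f x - f p| ≤ L / 2 * ‖x - p‖ ^ 2 := hf.abs_sub_le_of_gradient_eq_zero hp x
    _ ≤ L / 2 * (2 * (L * ε) / β) ^ 2 := by gcongr
    _ = 4 * (L / (2 * β ^ 2) * (L ^ 2 * ε ^ 2)) := by field_simp; ring
    _ ≤ 4 * stepCost L β ε := by
      unfold stepCost
      gcongr
      have : 0 < 1 / β := by positivity
      linarith

/-- With step length `‖∇f(x)‖ / β ≤ Lε/β`, the linear and quadratic terms of the descent lemma give
the two summands of `stepCost`. -/
theorem IsSecondOrderStep.apply_le (hf : Admissible f L M β) (hL : 0 < L) (hβ : 0 < β)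
    {x x' : E n} (h : IsSecondOrderStep f L β x x') {ε : ℝ}
    (hg : ‖gradient f x‖ ≤ L * ε) : f x' ≤ f x + stepCost L β ε := by
  have h1 := (abs_le.1 (hf.abs_sub_sub_inner_le x x')).2
  have h2 := real_inner_le_norm (gradient f x) (x' - x)
  rw [h.1] at h1 h2
  have h3 : ‖gradient f x‖ * (‖gradient f x‖ / β) + L / 2 * (‖gradient f x‖ / β) ^ 2 ≤
      stepCost L β ε := by
    calc _ ≤ (L * ε) * ((L * ε) / β) + L / 2 * ((L * ε) / β) ^ 2 := by
          have := (norm_nonneg _).trans hg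
          gcongr
      _ = stepCost L β ε := by unfold stepCost; field_simp
  linarith

theorem Step.eq_gdStep_or_isSecondOrderStep {ε Pmin : ℝ} {x x' : E n} {a b : Bool}
    (h : Step f L β ε Pmin (x, a) (x', b)) :
    x' = gdStep f L x ∨ ‖gradient f x‖ ≤ L * ε ∧ IsSecondOrderStep f L β x x' := by
  cases h with
  | large_gradient => exact Or.inl rfl
  | flagged => exact Or.inl rfl
  | high_curvature _ _ hg _ _ hx' => exact Or.inr ⟨hg, hx'⟩
  | low_curvature _ _ hg _ _ _ hx' => exact Or.inr ⟨hg, hx'⟩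
  | no_check => exact Or.inl rfl

theorem norm_sub_le_farthestRadius (p : E n) {T k : ℕ} (x : ℕ → E n) (hk : k ≤ T) :
    ‖x k - p‖ ≤ farthestRadius p T x :=
  Finset.le_sup' (fun k => ‖x k - p‖) (Finset.mem_range.2 (by omega))

/-! ### Size of `γ` and of the diameter -/

/-- A lower bound for the gradient away from the critical points is at most of the order of
`L * ξ`, provided that the domain contains points at distance slightly more than `ξ` from a
critical point. -/
theorem Admissible.le_of_forall_le_norm_gradient (hf : Admissible f L M β) (hL : 0 < L)
    {U : Set (E n)} {R ξ γ ρ : ℝ}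
    (hsep : ∀ p ∈ criticalIn f U, ∀ q ∈ criticalIn f U, p ≠ q → R ≤ ‖p - q‖) (hξ : 0 < ξ)
    (hγ : ∀ y ∈ U, (∀ p ∈ criticalIn f U, y ∉ Metric.closedBall p ξ) → γ ≤ ‖gradient f y‖)
    (hξR : 50 * ξ ≤ R) {p e : E n} (hp : p ∈ criticalIn f U) (he : ‖e‖ = 1) (hξρ : ξ < ρ)
    (hball : Metric.ball p ρ ⊆ U) : γ ≤ 11 / 10 * (L * ξ) := by
  -- A radius strictly between `ξ` and `ρ`, small enough for the point to avoid every other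
  -- `ξ`-ball.
  set t := min ((ξ + ρ) / 2) (11 / 10 * ξ)
  have ht1 : ξ < t := lt_min (by linarith) (by linarith)
  have ht2 : t < ρ := (min_le_left _ _).trans_lt (by linarith)
  have ht3 : t ≤ 11 / 10 * ξ := min_le_right _ _
  have hnorm : ‖p + t • e - p‖ = t := by
    rw [add_sub_cancel_left, norm_smul, he, mul_one, Real.norm_of_nonneg (by linarith)]
  have hgrad : γ ≤ ‖gradient f (p + t • e)‖ := by
    refine hγ _ (hball (by rwa [mem_ball_iff_norm, hnorm])) fun q hq hmem => ?_
    rw [mem_closedBall_iff_norm] at hmem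
    by_cases hpq : p = q
    · subst hpq; linarith
    · have h1 := hsep p hp q hq hpq
      have h2 : ‖p - q‖ ≤ ‖p + t • e - p‖ + ‖p + t • e - q‖ := by
        rw [norm_sub_rev _ p]; exact norm_sub_le_norm_sub_add_norm_sub p _ q
      linarith
  have h3 := hf.norm_gradient_le hp.2 (p + t • e)
  rw [hnorm] at h3
  have := mul_le_mul_of_nonneg_left ht3 hL.le
  linarith

theorem two_mul_le_diam_of_ball_subset {U : Set (E n)} (hU : Bornology.IsBounded U) {p e : E n}
    (he : ‖e‖ = 1) {t ρ : ℝ} (ht : 0 ≤ t) (htρ : t < ρ) (hball : Metric.ball p ρ ⊆ U) :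
    2 * t ≤ Metric.diam U := by
  have h1 : p + t • e ∈ U := hball <| by
    rwa [mem_ball_iff_norm, add_sub_cancel_left, norm_smul, he, mul_one, Real.norm_of_nonneg ht]
  have h2 : p - t • e ∈ U := hball <| by
    rwa [mem_ball_iff_norm, sub_sub_cancel_left, norm_neg, norm_smul, he, mul_one,
      Real.norm_of_nonneg ht]
  have h3 := Metric.dist_le_diam_of_mem hU h1 h2
  rw [dist_eq_norm, show p + t • e - (p - t • e) = (2 * t) • e by module, norm_smul, he, mul_one,
    Real.norm_of_nonneg (by positivity)] at h3
  exact h3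

/-! ### Counting the saddles -/

/-- The strict saddles met by a trajectory within `U` are finitely many, and their number is
controlled by the decrease of `f` along the trajectory. -/
theorem IsTrajectory.finite_saddlesMet (hf : Admissible f L M β) (hL : 0 < L)
    (hM : 0 < M) (hβ : 0 < β) {U : Set (E n)} {R ξ γ ε Pmin : ℝ} (hR : 0 < R)
    (hsep : ∀ p ∈ criticalIn f U, ∀ q ∈ criticalIn f U, p ≠ q → R ≤ ‖p - q‖)
    (hε : 0 < ε) (hεγ : L * ε < γ)
    (hγ : ∀ y ∈ U, (∀ p ∈ criticalIn f U, y ∉ Metric.closedBall p ξ) → γ ≤ ‖gradient f y‖)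
    (hγξ : γ ≤ 11 / 10 * (L * ξ)) (hξM : M * ξ ≤ β) (hξR : 50 * ξ ≤ R)
    (hεR : 50 * stepCost L β ε ≤ γ * R) {T : ℕ} {x : ℕ → E n} {Ξ : ℕ → Bool}
    (htraj : IsTrajectory f L β ε Pmin T x Ξ) (hxU : ∀ k ≤ T, x k ∈ U)
    {p₀ : E n} (hp₀ : p₀ ∈ criticalIn f U) (hx₀ : x 0 ∈ Metric.closedBall p₀ ξ) :
    (saddlesMet f U ξ T x).Finite ∧
      ((saddlesMet f U ξ T x).ncard - 1) * (57 / 200 * (γ * R)) ≤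
        f (x 0) - f (x T) + 9 * stepCost L β ε := by
  have hγ0 : 0 < γ := lt_trans (by positivity) hεγ
  have hc := stepCost_nonneg hL hβ ε
  -- `L/2 (Lε/β)² ≤ c ≤ γR/50 ≤ 11/25000 L R²`, and `22/25000 ≤ (3/100)²`.
  have hjump : L * ε / β ≤ 3 / 100 * R := by
    refine (sq_le_sq₀ (by positivity) (by positivity)).1 ?_
    have h1 : L / 2 * (L * ε / β) ^ 2 ≤ stepCost L β ε := by
      have : L / 2 * (L * ε / β) ^ 2 = L / (2 * β ^ 2) * (L ^ 2 * ε ^ 2) := by field_simp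
      rw [this, stepCost]
      gcongr
      have : 0 < 1 / β := by positivity
      linarith
    have h2 : γ * R ≤ 11 / 10 * (L * (R / 50)) * R := by
      have h3 : L * ξ ≤ L * (R / 50) := mul_le_mul_of_nonneg_left (by linarith) hL.le
      exact mul_le_mul_of_nonneg_right (by linarith) hR.le
    refine le_of_mul_le_mul_left (a := L) ?_ hL
    nlinarith [mul_nonneg hL.le (sq_nonneg R)]
  obtain ⟨V, hV, q, -, -, -, hpot⟩ := exists_finset_centers_potential (criticalIn f U) f
    (fun k => f (x k)) x T (s := 3 / 100 * R) hc hγ0.le hR hsep hξR (by linarith) (by positivity)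
    hεR hp₀ (mem_closedBall_iff_norm.1 hx₀) (fun t ht => by
      have hxt := hxU t ht.le
      rcases (htraj.2 t ht).eq_gdStep_or_isSecondOrderStep with h | ⟨hg, h⟩
      · left
        have hdesc := hf.apply_gdStep_le hL (x t)
        rw [h, norm_gdStep_sub hL]
        refine ⟨?_, ?_, fun hout => ?_⟩
        · have : 0 ≤ ‖gradient f (x t)‖ ^ 2 / (2 * L) := by positivity
          linarith
        · rintro ⟨q, hq, hxq⟩
          rw [div_le_iff₀ hL]
          have h1 := hf.norm_gradient_le hq.2 (x t)
          have h2 := mul_le_mul_of_nonneg_left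
            (show ‖x t - q‖ ≤ 3 / 100 * R by linarith) hL.le
          linarith
        · have hge := hγ _ hxt fun q hq hmem =>
            (hout q hq).not_ge (mem_closedBall_iff_norm.1 hmem)
          have h1 : γ / 2 * (‖gradient f (x t)‖ / L) ≤ ‖gradient f (x t)‖ ^ 2 / (2 * L) := by
            rw [show γ / 2 * (‖gradient f (x t)‖ / L) = γ * ‖gradient f (x t)‖ / (2 * L) by
              field_simp, sq]
            gcongr
          linarith
      · right
        -- Outside all `ξ`-balls the gradient is at least `γ > Lε`, too large for a jump.
        have hin : ∃ q ∈ criticalIn f U, x t ∈ Metric.closedBall q ξ := by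
          by_contra! hcon
          linarith [hγ _ hxt hcon]
        obtain ⟨q, hq, hxq⟩ := hin
        rw [mem_closedBall_iff_norm] at hxq
        refine ⟨q, hq, hxq, hf.abs_sub_le_stepCost hL hβ hq.2 ?_ hg, h.apply_le hf hL hβ hg, ?_⟩
        · exact (mul_le_mul_of_nonneg_left hxq hM.le).trans hξM
        · rw [h.1]
          exact le_trans (by gcongr) hjump) T le_rfl
  have hsub : saddlesMet f U ξ T x ⊆ V := by
    rintro p ⟨⟨hpU, hps⟩, k, hk, hkp⟩
    exact hV p ⟨hpU, hps.1⟩ ⟨k, hk, mem_closedBall_iff_norm.1 hkp⟩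
  have hcard : ((saddlesMet f U ξ T x).ncard : ℝ) ≤ V.card := by
    have := Set.ncard_le_ncard hsub V.finite_toSet
    rw [Set.ncard_coe_finset] at this
    exact_mod_cast this
  refine ⟨V.finite_toSet.subset hsub, ?_⟩
  have h1 := mul_le_mul_of_nonneg_right hcard (show 0 ≤ 57 / 200 * (γ * R) by positivity)
  have h2 : 0 ≤ γ / 2 * max 0 (‖x T - q‖ - ξ - 3 / 100 * R) := by positivity
  rcases hpot with h | ⟨-, h⟩ <;> linarith

end CCRGD

theorem mainTheorem6 {n : ℕ} (f : CCRGD.E n → ℝ) (L M β : ℝ)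
    (hL : 0 < L) (hM : 0 < M) (hβ : 0 < β) (hf : CCRGD.Admissible f L M β)
    -- the compact domain, its critical points and their separation `R`
    (U : Set (CCRGD.E n)) (hU : IsCompact U) (R : ℝ) (hR : 0 < R)
    (hcrit : (CCRGD.criticalIn f U).Nontrivial)
    (hsep : ∀ p ∈ CCRGD.criticalIn f U, ∀ q ∈ CCRGD.criticalIn f U, p ≠ q → R ≤ ‖p - q‖)
    -- the neighbourhood radii `ε`, `ξ` and the lower bound `γ` for the gradient
    (ε ξ γ : ℝ) (hε : 0 < ε) (hξ : 0 < ξ) (hεγ : L * ε < γ)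
    (hγ : ∀ y ∈ U, (∀ p ∈ CCRGD.criticalIn f U, y ∉ Metric.closedBall p ξ) →
      γ ≤ ‖gradient f y‖)
    (hξM : M * ξ ≤ β) (hξR : 50 * ξ ≤ R) (hεR : 50 * CCRGD.stepCost L β ε ≤ γ * R)
    -- the trajectory starts near the saddle `p₀`, leaves its `R₀`-ball and is back at time `T`
    (Pmin : ℝ) (T : ℕ) (x : ℕ → CCRGD.E n) (Ξ : ℕ → Bool)
    (htraj : CCRGD.IsTrajectory f L β ε Pmin T x Ξ)
    (p₀ : CCRGD.E n) (hp₀ : p₀ ∈ CCRGD.saddlesIn f U)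
    (hx₀ : x 0 ∈ Metric.closedBall p₀ ξ)
    (R₀ : ℝ) (hξR₀ : ξ ≤ R₀)
    (hleave : ∃ k ≤ T, x k ∉ Metric.closedBall p₀ R₀)
    (hreturn : x T ∈ Metric.closedBall p₀ R₀)
    (hball : Metric.ball p₀ (CCRGD.farthestRadius p₀ T x) ⊆ U)
    -- upper bounds for the exit and sojourn times
    (Kexit Kshell : ℝ)
    (hKexit : (CCRGD.exitTime f U ε T x : ℝ) ≤ Kexit)
    (hKshell : (CCRGD.shellTime f U ε ξ T x : ℝ) ≤ Kshell)
    (hdenom : 0 < CCRGD.denomN L β ε ξ γ R Kexit Kshell) :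
    CCRGD.farthestRadius p₀ T x ≤
        R₀ + 2 * L * Metric.diam U * (R₀ / γ)
          + CCRGD.boundN L β ε ξ γ R (Metric.diam U) R₀ Kexit Kshell
            * (CCRGD.stepCost L β ε / γ)
          + CCRGD.boundN L β ε ξ γ R (Metric.diam U) R₀ Kexit Kshell * (Kexit + Kshell) * ξ ∧
      (CCRGD.saddlesMet f U ξ T x).Finite ∧
      ((CCRGD.saddlesMet f U ξ T x).ncard : ℝ) ≤
        CCRGD.boundN L β ε ξ γ R (Metric.diam U) R₀ Kexit Kshell := by

  obtain ⟨k₀, hk₀, hk₀R⟩ := hleave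
  rw [mem_closedBall_iff_norm, not_le] at hk₀R
  have hω : R₀ < CCRGD.farthestRadius p₀ T x :=
    hk₀R.trans_le (CCRGD.norm_sub_le_farthestRadius p₀ x hk₀)
  set ω := CCRGD.farthestRadius p₀ T x
  have hR₀ : 0 < R₀ := hξ.trans_le hξR₀
  have hγ0 : 0 < γ := lt_trans (by positivity) hεγ
  have hp₀c : p₀ ∈ CCRGD.criticalIn f U := ⟨hp₀.1, hp₀.2.1⟩
  -- A second critical point supplies a direction `e` and gives `R ≤ diam U`.
  obtain ⟨p₁, hp₁, hne⟩ := hcrit.exists_ne p₀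
  obtain ⟨e, he⟩ : ∃ e : CCRGD.E n, ‖e‖ = 1 :=
    ⟨(‖p₁ - p₀‖⁻¹ : ℝ) • (p₁ - p₀), norm_smul_inv_norm (𝕜 := ℝ) (sub_ne_zero.2 hne)⟩
  have hγξ : γ ≤ 11 / 10 * (L * ξ) :=
    hf.le_of_forall_le_norm_gradient hL hsep hξ hγ hξR hp₀c he (hξR₀.trans_lt hω) hball
  have hxU : ∀ k ≤ T, x k ∈ U := by
    intro k hk
    -- The farthest iterate lies on the boundary of the open ball, so closedness of `U` is needed.
    refine closure_minimal hball hU.isClosed ?_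
    rw [closure_ball p₀ (hR₀.trans hω).ne', mem_closedBall_iff_norm]
    exact CCRGD.norm_sub_le_farthestRadius p₀ x hk
  obtain ⟨hfin, hcard⟩ := htraj.finite_saddlesMet hf hL hM hβ hR hsep hε hεγ hγ hγξ hξM hξR hεR
    hxU hp₀c hx₀
  set N : ℝ := ((CCRGD.saddlesMet f U ξ T x).ncard : ℝ)
  set D := Metric.diam U
  have hDω : ω + R₀ ≤ D := by
    have := CCRGD.two_mul_le_diam_of_ball_subset (t := (ω + R₀) / 2) hU.isBounded he
      (by linarith) (by linarith) hball
    linarith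
  have hDR : R ≤ D := by
    have h1 := hsep p₁ hp₁ p₀ hp₀c hne
    rw [← dist_eq_norm] at h1
    exact h1.trans (Metric.dist_le_diam_of_mem hU.isBounded hp₁.1 hp₀.1)
  have hD0 : 0 < D := hR.trans_le hDR
  have hc := CCRGD.stepCost_nonneg hL hβ ε
  have hK : 0 ≤ Kexit + Kshell :=
    add_nonneg ((Nat.cast_nonneg _).trans hKexit) ((Nat.cast_nonneg _).trans hKshell)
  have hγR₀ : γ ≤ 11 / 10 * (L * R₀) := by
    linarith [mul_le_mul_of_nonneg_left hξR₀ hL.le]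
  have hN₀ : 0 ≤ CCRGD.boundN L β ε ξ γ R D R₀ Kexit Kshell := by
    unfold CCRGD.boundN; positivity
  refine ⟨?_, hfin, ?_⟩
  · have h1 : D ≤ 2 * L * D * (R₀ / γ) := by
      rw [← mul_div_assoc, le_div_iff₀ hγ0]
      nlinarith [mul_le_mul_of_nonneg_left hγR₀ hD0.le, mul_pos (mul_pos hL hD0) hR₀]
    have h2 : 0 ≤ CCRGD.boundN L β ε ξ γ R D R₀ Kexit Kshell * (CCRGD.stepCost L β ε / γ) := by
      positivity
    have h3 : 0 ≤ CCRGD.boundN L β ε ξ γ R D R₀ Kexit Kshell * (Kexit + Kshell) * ξ := by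
      positivity
    linarith
  · have hΔ : CCRGD.denomN L β ε ξ γ R Kexit Kshell ≤ γ / 2 := by
      have h1 : 0 ≤ CCRGD.stepCost L β ε / R := by positivity
      have h2 : 0 ≤ γ * (Kexit + Kshell) * (ξ / R) := by positivity
      unfold CCRGD.denomN
      linarith
    have hdrop : f (x 0) - f (x T) ≤ L * R₀ * (D / 2) := by
      have h1 := (abs_le.1 (hf.abs_sub_le_of_gradient_eq_zero hp₀c.2 (x 0))).2
      have h2 := (abs_le.1 (hf.abs_sub_le_of_gradient_eq_zero hp₀c.2 (x T))).1
      have h3 : L / 2 * ‖x 0 - p₀‖ ^ 2 ≤ L / 2 * R₀ ^ 2 := by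
        gcongr
        exact (mem_closedBall_iff_norm.1 hx₀).trans hξR₀
      have h4 : L / 2 * ‖x T - p₀‖ ^ 2 ≤ L / 2 * R₀ ^ 2 := by
        gcongr
        exact mem_closedBall_iff_norm.1 hreturn
      have h5 : L * R₀ * R₀ ≤ L * R₀ * (D / 2) := by
        gcongr
        linarith
      nlinarith
    have hγRD : γ * R ≤ 11 / 10 * (L * R₀ * D) := by
      calc γ * R ≤ 11 / 10 * (L * R₀) * D := by gcongr
        _ = _ := by ring
    have hpos : 0 < L * R₀ * D := by positivity
    -- `57/200 NγR` is at most `1/2 + 93/200 · 11/10 < 57/50` times `L R₀ D`; here `93/200` collects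
    -- `9c ≤ 9/50 γR` and the starting centre.
    have hNγ : N * (γ * R) ≤ 4 * (L * R₀ * D) := by linarith
    have hN : 0 ≤ N := Nat.cast_nonneg _
    unfold CCRGD.boundN
    rw [le_div_iff₀ hdenom]
    calc N * CCRGD.denomN L β ε ξ γ R Kexit Kshell ≤ N * (γ / 2) := by gcongr
      _ ≤ 2 * L * D * (R₀ / R) := by
        rw [← mul_div_assoc (2 * L * D), le_div_iff₀ hR]
        linarith
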